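/- Let $N, C_N$ be integers with $1\le C_N\le N$ and let $\mu,\nu>0$ with $\mu+\nu=1$. The Engset process $(X_N(t))_{t\ge 0}$ is the (right-continuous) Markov birth and death process on $\{0,1,\ldots,C_N\}$ with $Q$-matrix given by $$q(x,x-1)=\mu x\quad (0\le x\le C_N),\qquad q(x,x+1)=\nu(N-x)\quad (0\le x<C_N),$$ i.e. the Ehrenfest process on $\{0,\ldots,N\}$ reflected at $C_N$. Let $\mathbb{E}_z$ denote expectation when $X_N(0)=z$ almost surely, and let $T_z^{X_N}=\inf\{s\ge 0: X_N(s)=z\}$ (equal to $+\infty$ if $z$ is never reached, with $e^{-\alpha T}=0$ on $\{T=+\infty\}$). For $\alpha>0$ and $0\le x\le C_N$ set $$B_x(\alpha)=\int_0^1(1-u)^x\Bigl(1+\frac{\nu}{\mu}u\Bigr)^{N-x}u^{\alpha-1}\,du,\qquad D_x(\alpha)=\int_0^1(1-u)^{N-x}\Bigl(1+\frac{\mu}{\nu}u\Bigr)^{x}u^{\alpha-1}\,du,$$ $$b_N(\alpha)=\nu\int_0^1(1-u)^{C_N}\Bigl(1+\frac{\nu}{\mu}u\Bigr)^{N-C_N-1}u^{\alpha}\,du,\qquad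 d_N(\alpha)=\mu\int_0^1(1-u)^{N-C_N-1}\Bigl(1+\frac{\mu}{\nu}u\Bigr)^{C_N}u^{\alpha}\,du .$$ Then, for all $0\le x\le y\le C_N$ and all $\alpha>0$, $$\mathbb{E}_x\bigl(e^{-\alpha T_y^{X_N}}\bigr)=\frac{D_x(\alpha)}{D_y(\alpha)}\qquad\text{and}\qquad \mathbb{E}_y\bigl(e^{-\alpha T_x^{X_N}}\bigr)=\frac{d_N(\alpha)B_y(\alpha)+b_N(\alpha)D_y(\alpha)}{d_N(\alpha)B_x(\alpha)+b_N(\alpha)D_x(\alpha)},$$ where, if $C_N=N$ (in which case $d_N(\alpha)=+\infty$ while the other coefficients are finite), the last ratio is understood as $B_y(\alpha)/B_x(\alpha)$. Both identities also hold for $\alpha=0$, their right-hand sides being understood as limits when $\alpha\to 0^+$: both sides are then equal to $1$, i.e. the hitting times are almost surely finite and both ratios tend to $1$ as $\alpha\to0^+$. -/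

import Mathlib

open scoped NNReal Topology

noncomputable section

namespace Engset

/-- The `Q`-matrix of the Engset process with `N` sources, capacity `C` and rates `μ`, `ν`, a birth
and death process on `{0, …, C}`: death rate `μ x` at `x`, birth rate `ν (N - x)` at `x < C`, and no
birth at `x = C`. The rows sum to `0`. -/
def qMatrix (N C : ℕ) (μ ν : ℝ) : Matrix (Fin (C + 1)) (Fin (C + 1)) ℝ := fun x y =>
  if (y : ℕ) + 1 = x then μ * (x : ℕ)
  else if (y : ℕ) = x + 1 then ν * ((N : ℝ) - (x : ℕ))
  else if y = x then -(μ * (x : ℕ) + if (x : ℕ) < C then ν * ((N : ℝ) - (x : ℕ)) else 0)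
  else 0

/-- The `σ`-algebra generated by `X r`, `0 ≤ r ≤ s` (the natural filtration of `X` at time `s`). -/
@[reducible]
def past {Ω S : Type*} [MeasurableSpace S] (X : ℝ≥0 → Ω → S) (s : ℝ≥0) : MeasurableSpace Ω :=
  ⨆ r : ℝ≥0, ⨆ _ : r ≤ s, MeasurableSpace.comap (X r) inferInstance

/-- `X` is, under `P`, a right-continuous Markov process on the finite set `{0, …, n - 1}` with
`Q`-matrix `Q`: conditionally on the past up to time `s`, the probability that `X (s + t) = j` is
the entry `(X s, j)` of the transition matrix `exp (t Q)`. -/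
structure IsMarkovJumpProcess {Ω : Type*} [MeasurableSpace Ω] (P : MeasureTheory.Measure Ω) {n : ℕ}
    (Q : Matrix (Fin n) (Fin n) ℝ) (X : ℝ≥0 → Ω → Fin n) : Prop where
  measurable : ∀ t, Measurable (X t)
  right_continuous : ∀ ω t, ContinuousWithinAt (fun s => X s ω) (Set.Ici t) t
  markov : ∀ (s t : ℝ≥0) (i j : Fin n) (A : Set Ω), @MeasurableSet Ω (past X s) A →
    P.real (A ∩ {ω | X s ω = i} ∩ {ω | X (s + t) ω = j}) =
      P.real (A ∩ {ω | X s ω = i}) * (NormedSpace.exp ((t : ℝ) • Q)) i j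

/-- `X` is an Engset process under `P`. -/
def IsEngsetProcess {Ω : Type*} [MeasurableSpace Ω] (P : MeasureTheory.Measure Ω)
    (N C : ℕ) (μ ν : ℝ) (X : ℝ≥0 → Ω → Fin (C + 1)) : Prop :=
  IsMarkovJumpProcess P (qMatrix N C μ ν) X

/-- The hitting time `T_z = inf {s ≥ 0 : X s = z}`, equal to `⊤` when `z` is never reached. -/
def hitTime {Ω S : Type*} (X : ℝ≥0 → Ω → S) (z : S) : Ω → WithTop ℝ≥0 :=
  MeasureTheory.hittingAfter X {z} 0

/-- `e ^ (-α T)` for `T ∈ [0, ∞]`, with value `0` at `T = ∞`. -/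
def expNeg (α : ℝ) : WithTop ℝ≥0 → ℝ
  | ⊤ => 0
  | (t : ℝ≥0) => Real.exp (-(α * (t : ℝ)))

/-- The Laplace transform `E (e ^ (-α T))` of a random time with values in `[0, ∞]`. -/
def laplace {Ω : Type*} [MeasurableSpace Ω] (P : MeasureTheory.Measure Ω)
    (T : Ω → WithTop ℝ≥0) (α : ℝ) : ℝ :=
  ∫ ω, expNeg α (T ω) ∂P

/-- `B_x(α) = ∫₀¹ (1 - u)^x (1 + (ν/μ) u)^(N - x) u^(α - 1) du`, for `0 ≤ x ≤ N`. -/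
def B (N : ℕ) (μ ν : ℝ) (x : ℕ) (α : ℝ) : ℝ :=
  ∫ u in (0 : ℝ)..1, (1 - u) ^ x * (1 + ν / μ * u) ^ (N - x) * u ^ (α - 1)

/-- `D_x(α) = ∫₀¹ (1 - u)^(N - x) (1 + (μ/ν) u)^x u^(α - 1) du`, for `0 ≤ x ≤ N`. -/
def D (N : ℕ) (μ ν : ℝ) (x : ℕ) (α : ℝ) : ℝ :=
  ∫ u in (0 : ℝ)..1, (1 - u) ^ (N - x) * (1 + μ / ν * u) ^ x * u ^ (α - 1)

/-- `b_N(α) = ν ∫₀¹ (1 - u)^C (1 + (ν/μ) u)^(N - C - 1) u^α du`. -/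
def b (N C : ℕ) (μ ν : ℝ) (α : ℝ) : ℝ :=
  ν * ∫ u in (0 : ℝ)..1, (1 - u) ^ C * (1 + ν / μ * u) ^ ((N : ℤ) - C - 1) * u ^ α

/-- `d_N(α) = μ ∫₀¹ (1 - u)^(N - C - 1) (1 + (μ/ν) u)^C u^α du`; it is used for `C < N` only
(for `C = N` the integral diverges). -/
def d (N C : ℕ) (μ ν : ℝ) (α : ℝ) : ℝ :=
  μ * ∫ u in (0 : ℝ)..1, (1 - u) ^ ((N : ℤ) - C - 1) * (1 + μ / ν * u) ^ C * u ^ α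

/-- The ratio `D_x(α) / D_y(α)`. -/
def upRatio (N : ℕ) (μ ν : ℝ) (x y : ℕ) (α : ℝ) : ℝ :=
  D N μ ν x α / D N μ ν y α

/-- The ratio `(d_N B_y + b_N D_y) / (d_N B_x + b_N D_x)` at `α`, for `C < N`. For `C = N`, where
`d_N(α) = +∞` and the other coefficients are finite, it is understood as `B_y(α) / B_x(α)`. -/
def downRatio (N C : ℕ) (μ ν : ℝ) (x y : ℕ) (α : ℝ) : ℝ :=
  if C < N then
    (d N C μ ν α * B N μ ν y α + b N C μ ν α * D N μ ν y α) /
      (d N C μ ν α * B N μ ν x α + b N C μ ν α * D N μ ν x α)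
  else B N μ ν y α / B N μ ν x α

end Engset

end

/-!
Fix a state `z`. The function `w ↦ E_w (e^(-α T_z))` is characterised by the linear system
`Q f = α f` off `z`, `f z = 1`, and the proof solves this system explicitly.

*Probabilistic half* (`laplace_hitTime`). Let `f` solve the system and let `r = e^(-α δ)`. The chain
`X 0, X δ, X (2 δ), …` is Markov with transition matrix `exp (δ Q)`, and `r exp (δ Q) f = f + o(δ)`
off `z`, because `(Q - α) f` vanishes there. Hence the discounted values `r ^ k f (X (k δ))`, stopped
at the first grid visit to `z`, form a martingale up to an error at most `r ^ k o(δ)` at step `k`, and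
these errors add up to `o(δ) / (1 - e^(-α δ)) → 0`. By right-continuity the first grid visit to `z`
converges to `T_z` as `δ → 0`, and dominated convergence gives `f w = E_w (e^(-α T_z))`. Working on
a grid needs only the one-step Markov property; no stopping time in continuous time is involved.

*Analytic half* (`sum_qMatrix_mul_hitLaplace`). Integration by parts shows that `x ↦ D_x(α)` and
`x ↦ B_x(α)` solve the eigenvalue equation of the Ehrenfest generator for `x < N` and `x > 0`
respectively. The combination `d_N B + b_N D` takes equal values at `C` and `C + 1`, hence solves the
equation of the generator reflected at `C`, for all `0 < x ≤ C`. Gluing `D / D_z` on `{0, …, z}` to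
`(d_N B + b_N D) / (d_N B_z + b_N D_z)` on `{z, …, C}` gives the solution of the whole system, and it
contains both identities: the first below `z`, the second above. For `C = N` the birth rate vanishes
at `C`, and `B` alone replaces the combination.

*The case `α = 0`.* As `α → 0⁺` each of `α B_x(α)`, `α D_x(α)` tends to `1` (`tendsto_mul_betaInt`),
so both ratios tend to `1`. By dominated convergence the Laplace transforms tend to `P (T < ∞)`, their
value at `0`, which is therefore `1`.
-/

noncomputable section

namespace Engset

/-! ### Beta-type integrals -/

/-- The integral `∫₀¹ (1 - u)^a (1 + σ u)^c u^β du`. With `β = α - 1` it gives `B` and `D`, with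
`β = α` the coefficients `b` and `d`. -/
def betaInt (σ : ℝ) (a c : ℕ) (β : ℝ) : ℝ :=
  ∫ u in (0 : ℝ)..1, (1 - u) ^ a * (1 + σ * u) ^ c * u ^ β

lemma intervalIntegrable_betaInt (σ : ℝ) (a c : ℕ) {β : ℝ} (hβ : -1 < β) :
    IntervalIntegrable (fun u : ℝ => (1 - u) ^ a * (1 + σ * u) ^ c * u ^ β)
      MeasureTheory.volume 0 1 :=
  (intervalIntegral.intervalIntegrable_rpow' hβ).continuousOn_mul
    (Continuous.continuousOn (by fun_prop))

lemma betaInt_pos {σ : ℝ} (hσ : 0 < σ) (a c : ℕ) {β : ℝ} (hβ : -1 < β) :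
    0 < betaInt σ a c β := by
  refine intervalIntegral.intervalIntegral_pos_of_pos_on
    (intervalIntegrable_betaInt σ a c hβ) (fun u hu => ?_) one_pos
  have h1 : 0 < 1 - u := by linarith [hu.2]
  have h2 : 0 < u := hu.1
  positivity

/-- A pointwise identity between the polynomial factors, integrated. -/
lemma betaInt_add_mul {σ : ℝ} (a c a₁ c₁ a₂ c₂ : ℕ) (s t : ℝ) {α : ℝ} (hα : 0 < α)
    (h : ∀ u : ℝ, (1 - u) ^ a * (1 + σ * u) ^ c =
      s * ((1 - u) ^ a₁ * (1 + σ * u) ^ c₁) + t * ((1 - u) ^ a₂ * (1 + σ * u) ^ c₂) * u) :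
    betaInt σ a c (α - 1) = s * betaInt σ a₁ c₁ (α - 1) + t * betaInt σ a₂ c₂ α := by
  have i1 := intervalIntegrable_betaInt σ a₁ c₁ (β := α - 1) (by linarith)
  have i2 := intervalIntegrable_betaInt σ a₂ c₂ (β := α) (by linarith)
  unfold betaInt
  rw [← intervalIntegral.integral_const_mul, ← intervalIntegral.integral_const_mul,
    ← intervalIntegral.integral_add (i1.const_mul s) (i2.const_mul t)]
  refine intervalIntegral.integral_congr_Ioo_of_le zero_le_one fun u hu => ?_
  have h2 : u ^ α = u * u ^ (α - 1) := by
    rw [Real.rpow_sub_one hu.1.ne']; field_simp [hu.1.ne']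
  simp only [h2, h u]
  ring

lemma betaInt_succ_left (σ : ℝ) (a c : ℕ) {α : ℝ} (hα : 0 < α) :
    betaInt σ (a + 1) c (α - 1) = betaInt σ a c (α - 1) - betaInt σ a c α := by
  rw [betaInt_add_mul (a + 1) c a c a c 1 (-1) hα fun u => by ring]
  ring

lemma betaInt_succ_right (σ : ℝ) (a c : ℕ) {α : ℝ} (hα : 0 < α) :
    betaInt σ a (c + 1) (α - 1) = betaInt σ a c (α - 1) + σ * betaInt σ a c α := by
  rw [betaInt_add_mul a (c + 1) a c a c 1 σ hα fun u => by ring]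
  ring

/-- Integration by parts of `(1 - u)^(a+1) (1 + σ u)^c` against `α u^(α-1)`; the boundary terms
vanish. -/
lemma mul_betaInt_succ_left (σ : ℝ) (a c : ℕ) {α : ℝ} (hα : 0 < α) :
    α * betaInt σ (a + 1) c (α - 1) =
      (a + 1) * betaInt σ a c α - σ * c * betaInt σ (a + 1) (c - 1) α := by
  have i0 := intervalIntegrable_betaInt σ (a + 1) c (β := α - 1) (by linarith)
  have i1 := intervalIntegrable_betaInt σ a c (β := α) (by linarith)
  have i2 := intervalIntegrable_betaInt σ (a + 1) (c - 1) (β := α) (by linarith)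
  have key := intervalIntegral.integral_eq_sub_of_hasDerivAt_of_le (zero_le_one (α := ℝ))
    (f := fun u : ℝ => (1 - u) ^ (a + 1) * (1 + σ * u) ^ c * u ^ α)
    (f' := fun u : ℝ => α * ((1 - u) ^ (a + 1) * (1 + σ * u) ^ c * u ^ (α - 1))
      - (a + 1) * ((1 - u) ^ a * (1 + σ * u) ^ c * u ^ α)
      + σ * c * ((1 - u) ^ (a + 1) * (1 + σ * u) ^ (c - 1) * u ^ α))
    (Continuous.continuousOn (by
      have := Real.continuous_rpow_const hα.le
      fun_prop))
    (fun u hu => by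
      have h1 : HasDerivAt (fun u : ℝ => (1 - u) ^ (a + 1))
          (((a + 1 : ℕ) : ℝ) * (1 - u) ^ a * (-1)) u := by
        simpa using ((hasDerivAt_id u).const_sub 1).fun_pow (a + 1)
      have h2 : HasDerivAt (fun u : ℝ => (1 + σ * u) ^ c)
          ((c : ℝ) * (1 + σ * u) ^ (c - 1) * σ) u := by
        simpa using (((hasDerivAt_id u).const_mul σ).const_add 1).fun_pow c
      have h3 := Real.hasDerivAt_rpow_const (x := u) (p := α) (Or.inl hu.1.ne')
      refine ((h1.mul h2).mul h3).congr_deriv ?_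
      push_cast
      simp only [Pi.mul_apply]
      ring)
    (((i0.const_mul α).sub (i1.const_mul _)).add (i2.const_mul _))
  rw [intervalIntegral.integral_add ((i0.const_mul α).sub (i1.const_mul _)) (i2.const_mul _),
    intervalIntegral.integral_sub (i0.const_mul α) (i1.const_mul _),
    intervalIntegral.integral_const_mul, intervalIntegral.integral_const_mul,
    intervalIntegral.integral_const_mul] at key
  simp [Real.zero_rpow hα.ne'] at key
  unfold betaInt
  linarith

/-- The three-term recursion behind the eigenvalue equations for `B` and `D`. -/
lemma betaInt_recursion {σ : ℝ} (hσ : 0 < σ) (a c : ℕ) {α : ℝ} (hα : 0 < α) :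
    α * betaInt σ (a + 1) c (α - 1) =
      (a + 1) / (1 + σ) * (betaInt σ a (c + 1) (α - 1) - betaInt σ (a + 1) c (α - 1)) +
      σ * c / (1 + σ) * (betaInt σ (a + 2) (c - 1) (α - 1) - betaInt σ (a + 1) c (α - 1)) := by
  have hσ' : 1 + σ ≠ 0 := by positivity
  have h1 : betaInt σ a (c + 1) (α - 1) - betaInt σ (a + 1) c (α - 1) =
      (1 + σ) * betaInt σ a c α := by
    rw [betaInt_succ_left σ a c hα, betaInt_succ_right σ a c hα]; ring
  rw [mul_betaInt_succ_left σ a c hα, h1]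
  rcases c with _ | c
  · simp
    field_simp
  · have h2 : betaInt σ (a + 2) c (α - 1) - betaInt σ (a + 1) (c + 1) (α - 1) =
        -((1 + σ) * betaInt σ (a + 1) c α) := by
      rw [betaInt_succ_left σ (a + 1) c hα, betaInt_succ_right σ (a + 1) c hα]; ring
    rw [Nat.add_sub_cancel, h2]
    field_simp
    ring

lemma betaInt_le {σ : ℝ} (hσ : 0 < σ) (a c : ℕ) {α : ℝ} (hα : 0 < α) :
    betaInt σ a c α ≤ (1 + σ) ^ c := by
  have h := intervalIntegral.integral_mono_on (zero_le_one (α := ℝ))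
    (intervalIntegrable_betaInt σ a c (β := α) (by linarith))
    (intervalIntegrable_const (c := (1 + σ) ^ c)) (fun u hu => by
      have h0 : 0 ≤ 1 - u := by linarith [hu.2]
      have h1 : (1 - u) ^ a ≤ 1 := pow_le_one₀ h0 (by linarith [hu.1])
      have h2 : u ^ α ≤ 1 := Real.rpow_le_one hu.1 hu.2 hα.le
      have h3 : (1 + σ * u) ^ c ≤ (1 + σ) ^ c := by
        have := hu.1
        gcongr
        nlinarith [hu.2]
      have h4 : 0 ≤ u ^ α := Real.rpow_nonneg hu.1 _
      have h5 : 0 ≤ (1 + σ * u) ^ c := by have := hu.1; positivity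
      calc (1 - u) ^ a * (1 + σ * u) ^ c * u ^ α ≤ 1 * (1 + σ) ^ c * 1 := by gcongr
        _ = (1 + σ) ^ c := by ring)
  simpa [betaInt] using h

open Filter in
/-- As `α → 0⁺` the mass of `α u^(α-1) du` concentrates at `u = 0`, where the polynomial factor
equals `1`. -/
lemma tendsto_mul_betaInt {σ : ℝ} (hσ : 0 < σ) (a c : ℕ) :
    Tendsto (fun α : ℝ => α * betaInt σ a c (α - 1)) (𝓝[>] 0) (𝓝 1) := by
  have hJ : ∀ a c : ℕ, Tendsto (fun α : ℝ => α * betaInt σ a c α) (𝓝[>] 0) (𝓝 0) := by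
    intro a c
    have hid : Tendsto (fun α : ℝ => α * (1 + σ) ^ c) (𝓝[>] 0) (𝓝 0) := by
      have : Tendsto (fun α : ℝ => α * (1 + σ) ^ c) (𝓝 0) (𝓝 (0 * (1 + σ) ^ c)) :=
        tendsto_id.mul_const _
      rw [zero_mul] at this
      exact this.mono_left nhdsWithin_le_nhds
    refine tendsto_of_tendsto_of_tendsto_of_le_of_le' tendsto_const_nhds hid ?_ ?_
    · filter_upwards [self_mem_nhdsWithin] with α (hα : 0 < α)
      exact mul_nonneg hα.le (betaInt_pos hσ a c (by linarith)).le
    · filter_upwards [self_mem_nhdsWithin] with α (hα : 0 < α)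
      exact mul_le_mul_of_nonneg_left (betaInt_le hσ a c hα) hα.le
  induction a with
  | zero =>
    induction c with
    | zero =>
      refine tendsto_const_nhds.congr' ?_
      filter_upwards [self_mem_nhdsWithin] with α (hα : 0 < α)
      simp only [betaInt, pow_zero, one_mul]
      rw [integral_rpow (Or.inl (by linarith))]
      simp [Real.zero_rpow hα.ne', hα.ne']
    | succ c ih =>
      have := ih.add ((hJ 0 c).const_mul σ)
      rw [mul_zero, add_zero] at this
      refine this.congr' ?_
      filter_upwards [self_mem_nhdsWithin] with α (hα : 0 < α)
      rw [betaInt_succ_right σ 0 c hα]; ring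
  | succ a ih =>
    have := ih.sub (hJ a c)
    rw [sub_zero] at this
    refine this.congr' ?_
    filter_upwards [self_mem_nhdsWithin] with α (hα : 0 < α)
    rw [betaInt_succ_left σ a c hα]; ring

/-! ### One step of a Markov jump process -/

section MarkovStep

open MeasureTheory

variable {Ω : Type*} [MeasurableSpace Ω] {P : Measure Ω}

lemma setIntegral_comp_eq_sum {S : Type*} [Fintype S] [MeasurableSpace S]
    [MeasurableSingletonClass S] [IsFiniteMeasure P] {Y : Ω → S} (hY : Measurable Y) (g : S → ℝ)
    (A : Set Ω) :
    ∫ ω in A, g (Y ω) ∂P = ∑ i, P.real (A ∩ {ω | Y ω = i}) * g i := by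
  have hg : Measurable g := measurable_of_finite g
  rw [← integral_map (φ := Y) hY.aemeasurable hg.aestronglyMeasurable,
    integral_fintype .of_finite]
  refine Finset.sum_congr rfl fun i _ => ?_
  rw [smul_eq_mul, map_measureReal_apply hY (measurableSet_singleton i),
    measureReal_restrict_apply (hY (measurableSet_singleton i)), Set.inter_comm]
  rfl

variable {n : ℕ} {Q : Matrix (Fin n) (Fin n) ℝ} {X : ℝ≥0 → Ω → Fin n}

lemma past_le (hX : IsMarkovJumpProcess P Q X) (s : ℝ≥0) : past X s ≤ ‹MeasurableSpace Ω› :=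
  iSup_le fun r => iSup_le fun _ => (hX.measurable r).comap_le

omit [MeasurableSpace Ω] in
lemma measurableSet_past_preimage {s r : ℝ≥0} (hr : r ≤ s) (E : Set (Fin n)) :
    MeasurableSet[past X s] {ω | X r ω ∈ E} := by
  have h : MeasurableSpace.comap (X r) inferInstance ≤ past X s :=
    le_iSup_of_le r (le_iSup_of_le hr le_rfl)
  exact h _ ⟨E, MeasurableSet.of_discrete, rfl⟩

/-- The Markov property integrated against a function of the later state. -/
lemma setIntegral_add_eq_sum [IsFiniteMeasure P] (hX : IsMarkovJumpProcess P Q X)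
    (f : Fin n → ℝ) (s t : ℝ≥0) {A : Set Ω} (hA : MeasurableSet[past X s] A) :
    ∫ ω in A, f (X (s + t) ω) ∂P =
      ∑ i, P.real (A ∩ {ω | X s ω = i}) * ∑ j, NormedSpace.exp ((t : ℝ) • Q) i j * f j := by
  have h := setIntegral_comp_eq_sum (P := P) ((hX.measurable s).prodMk (hX.measurable (s + t)))
    (fun p => f p.2) A
  rw [h, Fintype.sum_prod_type]
  refine Finset.sum_congr rfl fun i _ => ?_
  rw [Finset.mul_sum]
  refine Finset.sum_congr rfl fun j _ => ?_
  rw [← mul_assoc, ← hX.markov s t i j A hA]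
  congr 2
  ext ω
  simp [and_assoc]

end MarkovStep

/-! ### The discounted chain on a time grid, stopped at its first visit to a state -/

section Grid

open MeasureTheory

variable {Ω : Type*} {n : ℕ}

/-- The paths that avoid `z` at the grid times `0, δ, …, k δ`. -/
def avoid (X : ℝ≥0 → Ω → Fin n) (z : Fin n) (δ : ℝ≥0) (k : ℕ) : Set Ω :=
  {ω | ∀ j ≤ k, X (j * δ) ω ≠ z}

open Classical in
/-- The discounted value `e^(-α m δ) f (X (m δ))`, where `m` is the smaller of `k` and the first
index of a grid point at which `X` is at `z`. -/
def stoppedValue (X : ℝ≥0 → Ω → Fin n) (z : Fin n) (f : Fin n → ℝ) (α : ℝ) (δ : ℝ≥0) :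
    ℕ → Ω → ℝ
  | 0, ω => f (X 0 ω)
  | k + 1, ω =>
    if ω ∈ avoid X z δ k then Real.exp (-(α * δ)) ^ (k + 1) * f (X ((k + 1 : ℕ) * δ) ω)
    else stoppedValue X z f α δ k ω

variable {X : ℝ≥0 → Ω → Fin n} {z : Fin n} {f : Fin n → ℝ} {α : ℝ} {δ : ℝ≥0}

lemma stoppedValue_of_forall_lt {k : ℕ} {ω : Ω} (h : ∀ j < k, X (j * δ) ω ≠ z) :
    stoppedValue X z f α δ k ω = Real.exp (-(α * δ)) ^ k * f (X (k * δ) ω) := by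
  cases k with
  | zero => simp [stoppedValue]
  | succ k =>
    have : ω ∈ avoid X z δ k := fun j hj => h j (Nat.lt_succ_of_le hj)
    rw [stoppedValue, if_pos this]

lemma stoppedValue_of_hit {m k : ℕ} {ω : Ω} (h : ∀ j < m, X (j * δ) ω ≠ z)
    (hm : X (m * δ) ω = z) (hk : m ≤ k) :
    stoppedValue X z f α δ k ω = Real.exp (-(α * δ)) ^ m * f z := by
  induction k, hk using Nat.le_induction with
  | base => rw [stoppedValue_of_forall_lt h, hm]
  | succ k hk ih =>
    have : ω ∉ avoid X z δ k := fun H => H m hk hm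
    rw [stoppedValue, if_neg this, ih]

lemma abs_stoppedValue_le (hα : 0 ≤ α) (k : ℕ) (ω : Ω) :
    |stoppedValue X z f α δ k ω| ≤ ∑ i, |f i| := by
  have hf : ∀ i, |f i| ≤ ∑ i, |f i| := fun i =>
    Finset.single_le_sum (f := fun i => |f i|) (fun _ _ => abs_nonneg _) (Finset.mem_univ i)
  induction k with
  | zero => exact hf _
  | succ k ih =>
    rw [stoppedValue]
    split_ifs
    · rw [abs_mul, abs_of_nonneg (by positivity)]
      have : Real.exp (-(α * δ)) ^ (k + 1) ≤ 1 :=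
        pow_le_one₀ (Real.exp_pos _).le (Real.exp_le_one_iff.2 (by
          have : 0 ≤ α * δ := by positivity
          linarith))
      exact (mul_le_of_le_one_left (abs_nonneg _) this).trans (hf _)
    · exact ih

variable [MeasurableSpace Ω] {P : Measure Ω} [IsProbabilityMeasure P]
  {Q : Matrix (Fin n) (Fin n) ℝ}

omit [MeasurableSpace Ω] in
lemma measurableSet_past_avoid (k : ℕ) : MeasurableSet[past X (k * δ)] (avoid X z δ k) := by
  have : avoid X z δ k = ⋂ j : ℕ, ⋂ _ : j ≤ k, {ω | X (j * δ) ω ∈ ({z}ᶜ : Set (Fin n))} := by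
    ext ω; simp [avoid]
  rw [this]
  refine MeasurableSet.iInter fun j => MeasurableSet.iInter fun hj => ?_
  exact measurableSet_past_preimage (by gcongr) _

omit [IsProbabilityMeasure P] in
lemma measurable_stoppedValue (hX : IsMarkovJumpProcess P Q X) (k : ℕ) :
    Measurable (stoppedValue X z f α δ k) := by
  have hf : Measurable f := measurable_of_finite f
  induction k with
  | zero => exact hf.comp (hX.measurable 0)
  | succ k ih =>
    exact Measurable.ite (past_le hX _ _ (measurableSet_past_avoid k))
      ((hf.comp (hX.measurable _)).const_mul _) ih

lemma integrable_stoppedValue (hX : IsMarkovJumpProcess P Q X) (hα : 0 ≤ α) (k : ℕ) :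
    Integrable (stoppedValue X z f α δ k) P :=
  Integrable.of_bound (measurable_stoppedValue hX k).aestronglyMeasurable (∑ i, |f i|)
    (.of_forall fun ω => abs_stoppedValue_le hα k ω)

/-- The total defect `∑_{i ≠ z} |(e^(-α δ) exp (δ Q) f - f) i|`; it controls the change in
expectation of `stoppedValue` over one step. -/
def defect (Q : Matrix (Fin n) (Fin n) ℝ) (z : Fin n) (f : Fin n → ℝ) (α δ : ℝ) : ℝ :=
  ∑ i, if i = z then 0
    else |Real.exp (-(α * δ)) * ∑ j, NormedSpace.exp (δ • Q) i j * f j - f i|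

/-- Only paths that have avoided `z` move, so the step from `k` to `k + 1` involves the values of
`e^(-α δ) exp (δ Q) f - f` off `z` alone. -/
lemma abs_integral_stoppedValue_succ_sub_le (hX : IsMarkovJumpProcess P Q X) (hα : 0 ≤ α)
    (k : ℕ) :
    |∫ ω, stoppedValue X z f α δ (k + 1) ω ∂P - ∫ ω, stoppedValue X z f α δ k ω ∂P| ≤
      Real.exp (-(α * δ)) ^ k * defect Q z f α δ := by
  classical
  have hf : Measurable f := measurable_of_finite f
  set r := Real.exp (-(α * δ)) with hr
  set A := avoid X z δ k with hA
  have hApast : MeasurableSet[past X (k * δ)] A := measurableSet_past_avoid k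
  have hAm : MeasurableSet A := past_le hX _ _ hApast
  have hint : ∀ t, Integrable (fun ω => f (X t ω)) (P.restrict A) := fun t =>
    Integrable.of_bound (hf.comp (hX.measurable t)).aestronglyMeasurable (∑ i, |f i|)
      (.of_forall fun ω => Finset.single_le_sum (f := fun i => |f i|)
        (fun _ _ => abs_nonneg _) (Finset.mem_univ _))
  have hdiff : (fun ω => stoppedValue X z f α δ (k + 1) ω - stoppedValue X z f α δ k ω) =
      A.indicator fun ω => r ^ (k + 1) * f (X (k * δ + δ) ω) - r ^ k * f (X (k * δ) ω) := by
    funext ω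
    by_cases h : ω ∈ A
    · rw [Set.indicator_of_mem h, stoppedValue, if_pos h,
        stoppedValue_of_forall_lt fun j hj => h j hj.le]
      push_cast
      rw [add_one_mul]
    · rw [Set.indicator_of_notMem h, stoppedValue, if_neg h, sub_self]
  rw [← integral_sub (integrable_stoppedValue hX hα _) (integrable_stoppedValue hX hα _), hdiff,
    integral_indicator hAm, integral_sub ((hint _).const_mul _) ((hint _).const_mul _),
    integral_const_mul, integral_const_mul, setIntegral_add_eq_sum hX f _ _ hApast,
    setIntegral_comp_eq_sum (hX.measurable _) f A, Finset.mul_sum, Finset.mul_sum,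
    ← Finset.sum_sub_distrib, defect, Finset.mul_sum]
  refine (Finset.abs_sum_le_sum_abs _ _).trans (Finset.sum_le_sum fun i _ => ?_)
  split_ifs with hi
  · have : A ∩ {ω | X (k * δ) ω = i} = ∅ := by
      ext ω
      simp only [Set.mem_inter_iff, Set.mem_ofPred_eq, Set.mem_empty_iff_false, iff_false, not_and]
      intro h
      rw [hi]
      exact h k le_rfl
    simp [this]
  · have h1 : P.real (A ∩ {ω | X (k * δ) ω = i}) ≤ 1 := measureReal_le_one
    have h2 : 0 ≤ P.real (A ∩ {ω | X (k * δ) ω = i}) := measureReal_nonneg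
    have h3 : 0 ≤ r ^ k := by positivity
    generalize ∑ j, NormedSpace.exp ((δ : ℝ) • Q) i j * f j = S
    calc _ = |P.real (A ∩ {ω | X (k * δ) ω = i}) * (r ^ k * (r * S - f i))| := by
            congr 1
            ring
      _ = P.real (A ∩ {ω | X (k * δ) ω = i}) * (r ^ k * |r * S - f i|) := by
            rw [abs_mul, abs_mul, abs_of_nonneg h2, abs_of_nonneg h3]
      _ ≤ _ := mul_le_of_le_one_left (by positivity) h1

lemma defect_nonneg (Q : Matrix (Fin n) (Fin n) ℝ) (z : Fin n) (f : Fin n → ℝ) (α δ : ℝ) :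
    0 ≤ defect Q z f α δ :=
  Finset.sum_nonneg fun i _ => by split_ifs <;> positivity

lemma abs_integral_stoppedValue_sub_le (hX : IsMarkovJumpProcess P Q X) (hα : 0 < α)
    (hδ : 0 < δ) (k : ℕ) :
    |∫ ω, stoppedValue X z f α δ k ω ∂P - ∫ ω, f (X 0 ω) ∂P| ≤
      defect Q z f α δ / (1 - Real.exp (-(α * δ))) := by
  set r := Real.exp (-(α * δ)) with hr
  have hr0 : 0 ≤ r := (Real.exp_pos _).le
  have hr1 : r < 1 := Real.exp_lt_one_iff.2 (by
    have : 0 < α * δ := mul_pos hα (by exact_mod_cast hδ)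
    linarith)
  have h1 : |∫ ω, stoppedValue X z f α δ k ω ∂P - ∫ ω, f (X 0 ω) ∂P| ≤
      ∑ i ∈ Finset.range k, r ^ i * defect Q z f α δ := by
    change |_ - ∫ ω, stoppedValue X z f α δ 0 ω ∂P| ≤ _
    rw [← Finset.sum_range_sub (fun k => ∫ ω, stoppedValue X z f α δ k ω ∂P)]
    exact (Finset.abs_sum_le_sum_abs _ _).trans
      (Finset.sum_le_sum fun i _ => abs_integral_stoppedValue_succ_sub_le hX hα.le i)
  have h2 : ∑ i ∈ Finset.range k, r ^ i ≤ (1 - r)⁻¹ := by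
    rw [← tsum_geometric_of_lt_one hr0 hr1]
    exact (summable_geometric_of_lt_one hr0 hr1).sum_le_tsum _ fun _ _ => by positivity
  rw [← Finset.sum_mul] at h1
  rw [div_eq_inv_mul]
  exact h1.trans (mul_le_mul_of_nonneg_right h2 (defect_nonneg _ _ _ _ _))

end Grid

/-! ### Small time steps -/

section SmallStep

open Filter

open scoped Matrix.Norms.Operator in
lemma hasDerivAt_exp_smul_apply {n : ℕ} (Q : Matrix (Fin n) (Fin n) ℝ) (i j : Fin n) :
    HasDerivAt (fun t : ℝ => NormedSpace.exp (t • Q) i j) (Q i j) 0 := by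
  have h := hasDerivAt_exp_smul_const (𝕂 := ℝ) Q (0 : ℝ)
  rw [zero_smul, NormedSpace.exp_zero, one_mul] at h
  exact (hasDerivAt_pi.1 ((hasDerivAt_pi.1 h) i)) j

/-- If `Q f = α f` off `z`, the defect of a step of length `δ` is `o(δ)`. -/
lemma tendsto_defect_div {n : ℕ} {Q : Matrix (Fin n) (Fin n) ℝ} {z : Fin n} {f : Fin n → ℝ}
    {α : ℝ} (hα : 0 < α) (hf : ∀ i, i ≠ z → ∑ j, Q i j * f j = α * f i) :
    Tendsto (fun δ : ℝ => defect Q z f α δ / (1 - Real.exp (-(α * δ)))) (𝓝[>] 0) (𝓝 0) := by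
  have hexp : HasDerivAt (fun δ : ℝ => Real.exp (-(α * δ))) (-α) 0 := by
    have := (((hasDerivAt_id (0 : ℝ)).const_mul α).neg).exp
    simpa using this
  have hden : Tendsto (fun δ : ℝ => δ⁻¹ * (1 - Real.exp (-(α * δ)))) (𝓝[>] 0) (𝓝 α) := by
    have h := (hexp.const_sub 1).tendsto_slope_zero_right
    simpa using h
  have hnum : Tendsto (fun δ : ℝ => δ⁻¹ * defect Q z f α δ) (𝓝[>] 0) (𝓝 0) := by
    have hi : ∀ i, Tendsto (fun δ : ℝ => δ⁻¹ * if i = z then 0 else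
        |Real.exp (-(α * δ)) * ∑ j, NormedSpace.exp (δ • Q) i j * f j - f i|)
        (𝓝[>] 0) (𝓝 0) := by
      intro i
      by_cases h : i = z
      · simp [h]
      · have hd : HasDerivAt (fun δ : ℝ =>
            Real.exp (-(α * δ)) * ∑ j, NormedSpace.exp (δ • Q) i j * f j) 0 0 := by
          have hs : HasDerivAt (fun δ : ℝ => ∑ j, NormedSpace.exp (δ • Q) i j * f j)
              (∑ j, Q i j * f j) 0 :=
            HasDerivAt.fun_sum fun j _ => (hasDerivAt_exp_smul_apply Q i j).mul_const (f j)
          refine (hexp.fun_mul hs).congr_deriv ?_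
          simp [hf i h, Matrix.one_apply]
        have hslope := hd.tendsto_slope_zero_right.abs
        rw [abs_zero] at hslope
        refine hslope.congr' ?_
        filter_upwards [self_mem_nhdsWithin] with δ (hδ : 0 < δ)
        rw [if_neg h, smul_eq_mul, abs_mul, abs_of_pos (inv_pos.2 hδ)]
        simp [Matrix.one_apply]
    simpa [defect, Finset.mul_sum] using tendsto_finsetSum Finset.univ fun i _ => hi i
  have h := hnum.div hden hα.ne'
  rw [zero_div] at h
  refine h.congr' ?_
  filter_upwards [self_mem_nhdsWithin] with δ (hδ : 0 < δ)
  exact mul_div_mul_left _ _ (inv_ne_zero hδ.ne')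

end SmallStep

/-! ### Laplace transforms of hitting times -/

section Hitting

open MeasureTheory Filter

variable {Ω : Type*} {n : ℕ} {X : ℝ≥0 → Ω → Fin n} {z : Fin n}

/-- By right-continuity the infimum in the hitting time is attained. -/
lemma hitTime_cases {ω : Ω} (hX : ∀ t, ContinuousWithinAt (fun s => X s ω) (Set.Ici t) t) :
    (hitTime X z ω = ⊤ ∧ ∀ t, X t ω ≠ z) ∨
      ∃ T : ℝ≥0, hitTime X z ω = T ∧ X T ω = z ∧ ∀ s < T, X s ω ≠ z := by
  by_cases h : ∀ t, X t ω ≠ z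
  · exact Or.inl ⟨hittingAfter_eq_top_iff.2 fun j _ => h j, h⟩
  · push Not at h
    obtain ⟨t, ht⟩ := h
    refine Or.inr ⟨sInf {i | X i ω = z}, ?_, ?_, fun s hs hsz => ?_⟩
    · have : ∃ j, (0 : ℝ≥0) ≤ j ∧ X j ω ∈ ({z} : Set (Fin n)) := ⟨t, zero_le, ht⟩
      rw [hitTime, hittingAfter_def]
      simp only [if_pos this, zero_le, true_and, Set.mem_singleton_iff]
    · have hglb := isGLB_csInf (s := {i | X i ω = z}) ⟨t, ht⟩ (OrderBot.bddBelow _)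
      have hfreq := hglb.frequently_mem ⟨t, ht⟩
      have hev := (hX (sInf {i | X i ω = z})).eventually
        ((isOpen_discrete {X (sInf {i | X i ω = z}) ω}).mem_nhds rfl)
      obtain ⟨s, hs, hs'⟩ := (hfreq.and_eventually hev).exists
      exact hs'.symm.trans hs
    · exact notMem_of_lt_csInf hs (OrderBot.bddBelow _) hsz

/-- Along the grids of mesh `1 / (k + 1)` up to time `k + 1`, the stopped discounted chain converges
to `e^(-α T)`: by right-continuity the first grid visit to `z` occurs at the first grid point after
the hitting time. -/
lemma tendsto_stoppedValue {f : Fin n → ℝ} (hfz : f z = 1) {α : ℝ} (hα : 0 < α) {ω : Ω}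
    (hX : ∀ t, ContinuousWithinAt (fun s => X s ω) (Set.Ici t) t) :
    Tendsto (fun k : ℕ => stoppedValue X z f α ((k : ℝ≥0) + 1)⁻¹ ((k + 1) ^ 2) ω) atTop
      (𝓝 (expNeg α (hitTime X z ω))) := by
  rcases hitTime_cases (z := z) hX with ⟨hT, hne⟩ | ⟨T, hT, hTz, hne⟩
  · rw [hT]
    change Tendsto _ _ (𝓝 0)
    have hlim : Tendsto (fun k : ℕ => Real.exp (-(α * ((k : ℝ) + 1))) * ∑ i, |f i|) atTop
        (𝓝 0) := by
      have h1 : Tendsto (fun k : ℕ => α * ((k : ℝ) + 1)) atTop atTop :=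
        (tendsto_atTop_add_const_right _ 1 tendsto_natCast_atTop_atTop).const_mul_atTop hα
      simpa using (Real.tendsto_exp_neg_atTop_nhds_zero.comp h1).mul_const (∑ i, |f i|)
    refine squeeze_zero_norm (fun k => ?_) hlim
    rw [stoppedValue_of_forall_lt fun j _ => hne _, Real.norm_eq_abs, abs_mul,
      abs_of_nonneg (by positivity), ← Real.exp_nat_mul]
    have he : ((((k + 1) ^ 2 : ℕ) : ℝ) * -(α * (((k : ℝ≥0) + 1)⁻¹ : ℝ≥0))) =
        -(α * ((k : ℝ) + 1)) := by
      push_cast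
      field_simp
    rw [he]
    exact mul_le_mul_of_nonneg_left (Finset.single_le_sum (f := fun i => |f i|)
        (fun _ _ => abs_nonneg _) (Finset.mem_univ _)) (Real.exp_pos _).le
  · rw [hT]
    change Tendsto _ _ (𝓝 (Real.exp (-(α * T))))
    -- `m k` is the index of the first grid point that is at least `T`
    set m : ℕ → ℕ := fun k => ⌈T * ((k : ℝ≥0) + 1)⌉₊ with hm
    have hge : ∀ k : ℕ, T ≤ m k * ((k : ℝ≥0) + 1)⁻¹ := fun k => by
      rw [← div_eq_mul_inv, le_div_iff₀ (by positivity)]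
      exact Nat.le_ceil _
    have hle : ∀ k : ℕ, (m k * ((k : ℝ≥0) + 1)⁻¹ : ℝ≥0) ≤ T + ((k : ℝ≥0) + 1)⁻¹ := fun k => by
      have h := (Nat.ceil_lt_add_one (zero_le (a := T * ((k : ℝ≥0) + 1)))).le
      calc (m k * ((k : ℝ≥0) + 1)⁻¹ : ℝ≥0) ≤ (T * ((k : ℝ≥0) + 1) + 1) * ((k : ℝ≥0) + 1)⁻¹ := by
            gcongr
        _ = T + ((k : ℝ≥0) + 1)⁻¹ := by field_simp
    have hτ : Tendsto (fun k : ℕ => (m k * ((k : ℝ≥0) + 1)⁻¹ : ℝ≥0)) atTop (𝓝 T) := by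
      refine tendsto_of_tendsto_of_tendsto_of_le_of_le tendsto_const_nhds ?_ hge hle
      have h : Tendsto (fun k : ℕ => ((k : ℝ≥0) + 1)⁻¹) atTop (𝓝 0) := by
        simpa using tendsto_one_div_add_atTop_nhds_zero_nat (𝕜 := ℝ≥0)
      simpa using h.const_add T
    have hτ' : Tendsto (fun k : ℕ => (m k * ((k : ℝ≥0) + 1)⁻¹ : ℝ≥0)) atTop (𝓝[≥] T) :=
      tendsto_nhdsWithin_iff.2 ⟨hτ, .of_forall hge⟩
    have hev : ∀ᶠ k : ℕ in atTop, X (m k * ((k : ℝ≥0) + 1)⁻¹) ω = z := by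
      have := (hX T).eventually ((isOpen_discrete {z}).mem_nhds hTz)
      exact hτ'.eventually this
    have hK : ∀ᶠ k : ℕ in atTop, m k ≤ (k + 1) ^ 2 := by
      filter_upwards [eventually_ge_atTop ⌈T⌉₊] with k hk
      refine Nat.ceil_le.2 ?_
      push_cast
      rw [pow_two]
      gcongr
      exact (Nat.ceil_le.1 hk).trans (by simp)
    have hlim : Tendsto (fun k : ℕ => Real.exp (-(α * (m k * ((k : ℝ≥0) + 1)⁻¹ : ℝ≥0)))) atTop
        (𝓝 (Real.exp (-(α * T)))) :=
      ((((NNReal.tendsto_coe.2 hτ).const_mul α).neg).rexp)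
    refine hlim.congr' ?_
    filter_upwards [hev, hK] with k h1 h2
    rw [stoppedValue_of_hit (m := m k) (fun j hj => hne _ ?_) h1 h2, hfz, mul_one,
      ← Real.exp_nat_mul]
    · congr 1
      push_cast
      ring
    · rw [← div_eq_mul_inv, div_lt_iff₀ (by positivity)]
      exact Nat.lt_ceil.1 hj

variable [MeasurableSpace Ω] {P : Measure Ω} [IsProbabilityMeasure P]
  {Q : Matrix (Fin n) (Fin n) ℝ}

omit [IsProbabilityMeasure P] in
lemma aestronglyMeasurable_expNeg_hitTime (hX : IsMarkovJumpProcess P Q X) {α : ℝ} (hα : 0 < α) :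
    AEStronglyMeasurable (fun ω => expNeg α (hitTime X z ω)) P :=
  aestronglyMeasurable_of_tendsto_ae atTop
    (fun k : ℕ => (measurable_stoppedValue (f := fun _ => 1) hX ((k + 1) ^ 2)).aestronglyMeasurable)
    (.of_forall fun ω => tendsto_stoppedValue (f := fun _ => 1) rfl hα (hX.right_continuous ω))

/-- A solution of `Q f = α f` off `z`, normalised by `f z = 1`, gives the Laplace transform of the
hitting time of `z`. -/
theorem laplace_hitTime (hX : IsMarkovJumpProcess P Q X) {f : Fin n → ℝ} {α : ℝ} (hα : 0 < α)
    (hf : ∀ i, i ≠ z → ∑ j, Q i j * f j = α * f i) (hfz : f z = 1) {w : Fin n}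
    (hw : ∀ᵐ ω ∂P, X 0 ω = w) : laplace P (hitTime X z) α = f w := by
  have h0 : ∫ ω, f (X 0 ω) ∂P = f w := by
    rw [integral_congr_ae (g := fun _ => f w) (hw.mono fun ω h => by simp only [h])]
    simp
  have hlim := tendsto_integral_of_dominated_convergence (μ := P) (fun _ => ∑ i, |f i|)
    (fun k : ℕ => (measurable_stoppedValue (z := z) (f := f) (α := α) (δ := ((k : ℝ≥0) + 1)⁻¹)
      hX ((k + 1) ^ 2)).aestronglyMeasurable) (integrable_const _)
    (fun k => .of_forall fun ω => abs_stoppedValue_le hα.le _ ω)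
    (.of_forall fun ω => tendsto_stoppedValue hfz hα (hX.right_continuous ω))
  refine tendsto_nhds_unique hlim ?_
  have hδ : Tendsto (fun k : ℕ => ((((k : ℝ≥0) + 1)⁻¹ : ℝ≥0) : ℝ)) atTop (𝓝[>] 0) := by
    refine tendsto_nhdsWithin_iff.2 ⟨?_, .of_forall fun k => ?_⟩
    · simpa using tendsto_one_div_add_atTop_nhds_zero_nat (𝕜 := ℝ)
    · exact NNReal.coe_pos.2 (by positivity)
  rw [tendsto_iff_dist_tendsto_zero]
  refine squeeze_zero (fun _ => dist_nonneg) (fun k => ?_) ((tendsto_defect_div hα hf).comp hδ)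
  rw [Real.dist_eq, ← h0]
  exact abs_integral_stoppedValue_sub_le hX hα (by positivity) _

lemma expNeg_le_one {α : ℝ} (hα : 0 ≤ α) (T : WithTop ℝ≥0) : ‖expNeg α T‖ ≤ 1 := by
  cases T with
  | top => simp [expNeg]
  | coe t =>
    change ‖Real.exp (-(α * t))‖ ≤ 1
    rw [Real.norm_of_nonneg (Real.exp_pos _).le]
    exact Real.exp_le_one_iff.2 (by
      have : 0 ≤ α * t := by positivity
      linarith)

lemma tendsto_expNeg (T : WithTop ℝ≥0) :
    Tendsto (fun α => expNeg α T) (𝓝[>] 0) (𝓝 (expNeg 0 T)) := by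
  cases T with
  | top => exact tendsto_const_nhds
  | coe t =>
    have : Continuous fun α : ℝ => Real.exp (-(α * t)) := by fun_prop
    exact (this.tendsto 0).mono_left nhdsWithin_le_nhds

/-- `E (e^(-α T))` tends to `P (T < ∞)` as `α → 0⁺`. -/
lemma tendsto_laplace_hitTime (hX : IsMarkovJumpProcess P Q X) (z : Fin n) :
    Tendsto (laplace P (hitTime X z)) (𝓝[>] 0) (𝓝 (laplace P (hitTime X z) 0)) := by
  refine tendsto_integral_filter_of_dominated_convergence (fun _ => 1) ?_ ?_
    (integrable_const _) (.of_forall fun ω => tendsto_expNeg _)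
  · filter_upwards [self_mem_nhdsWithin] with α hα
    exact aestronglyMeasurable_expNeg_hitTime hX hα
  · filter_upwards [self_mem_nhdsWithin] with α (hα : 0 < α)
    exact .of_forall fun ω => expNeg_le_one hα.le _

end Hitting

/-! ### Eigenvalue equations for the Engset generator -/

section Equations

open Filter

variable {N C : ℕ} {μ ν α : ℝ}

lemma B_pos (hμ : 0 < μ) (hν : 0 < ν) (hα : 0 < α) (x : ℕ) : 0 < B N μ ν x α :=
  betaInt_pos (div_pos hν hμ) _ _ (by linarith)

lemma D_pos (hμ : 0 < μ) (hν : 0 < ν) (hα : 0 < α) (x : ℕ) : 0 < D N μ ν x α :=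
  betaInt_pos (div_pos hμ hν) _ _ (by linarith)

lemma b_eq_betaInt (h : C < N) : b N C μ ν α = ν * betaInt (ν / μ) C (N - C - 1) α := by
  have : (N : ℤ) - C - 1 = ((N - C - 1 : ℕ) : ℤ) := by omega
  simp only [b, betaInt, this, zpow_natCast]

lemma d_eq_betaInt (h : C < N) : d N C μ ν α = μ * betaInt (μ / ν) (N - C - 1) C α := by
  have : (N : ℤ) - C - 1 = ((N - C - 1 : ℕ) : ℤ) := by omega
  simp only [d, betaInt, this, zpow_natCast]

lemma b_pos (hμ : 0 < μ) (hν : 0 < ν) (hα : 0 < α) (h : C < N) : 0 < b N C μ ν α := by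
  rw [b_eq_betaInt h]
  exact mul_pos hν (betaInt_pos (div_pos hν hμ) _ _ (by linarith))

lemma d_pos (hμ : 0 < μ) (hν : 0 < ν) (hα : 0 < α) (h : C < N) : 0 < d N C μ ν α := by
  rw [d_eq_betaInt h]
  exact mul_pos hμ (betaInt_pos (div_pos hμ hν) _ _ (by linarith))

lemma D_recursion (hμ : 0 < μ) (hν : 0 < ν) (hμν : ν + μ = 1) (hα : 0 < α) {x : ℕ} (hx : x < N) :
    μ * x * (D N μ ν (x - 1) α - D N μ ν x α) +
      ν * (N - x) * (D N μ ν (x + 1) α - D N μ ν x α) = α * D N μ ν x α := by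
  obtain ⟨a, rfl⟩ : ∃ a, N = x + (a + 1) := ⟨N - x - 1, by omega⟩
  have h := betaInt_recursion (div_pos hμ hν) a x hα
  have h1 : (1 : ℝ) + μ / ν = 1 / ν := by field_simp; exact hμν
  have e0 : D (x + (a + 1)) μ ν x α = betaInt (μ / ν) (a + 1) x (α - 1) := by
    simp [D, betaInt]
  have e1 : D (x + (a + 1)) μ ν (x + 1) α = betaInt (μ / ν) a (x + 1) (α - 1) := by
    have : x + (a + 1) - (x + 1) = a := by omega
    simp only [D, betaInt, this]
  have e2 : (x : ℝ) * D (x + (a + 1)) μ ν (x - 1) α =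
      x * betaInt (μ / ν) (a + 2) (x - 1) (α - 1) := by
    rcases x with _ | x
    · simp
    · have : x + 1 + (a + 1) - (x + 1 - 1) = a + 2 := by omega
      simp only [D, betaInt, this]
  rw [h1] at h
  rw [e0, e1, h, mul_sub, mul_assoc, e2]
  push_cast
  field_simp
  ring

lemma B_recursion (hμ : 0 < μ) (hν : 0 < ν) (hμν : ν + μ = 1) (hα : 0 < α) {x : ℕ} (hx0 : 0 < x)
    (hx : x ≤ N) :
    μ * x * (B N μ ν (x - 1) α - B N μ ν x α) +
      ν * (N - x) * (B N μ ν (x + 1) α - B N μ ν x α) = α * B N μ ν x α := by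
  obtain ⟨a, rfl⟩ : ∃ a, x = a + 1 := ⟨x - 1, by omega⟩
  obtain ⟨c, rfl⟩ : ∃ c, N = (a + 1) + c := ⟨N - (a + 1), by omega⟩
  have h := betaInt_recursion (div_pos hν hμ) a c hα
  have h1 : (1 : ℝ) + ν / μ = 1 / μ := by field_simp; rw [add_comm]; exact hμν
  have e0 : B (a + 1 + c) μ ν (a + 1) α = betaInt (ν / μ) (a + 1) c (α - 1) := by
    simp [B, betaInt]
  have e1 : B (a + 1 + c) μ ν (a + 1 - 1) α = betaInt (ν / μ) a (c + 1) (α - 1) := by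
    have : a + 1 + c - a = c + 1 := by omega
    simp only [B, betaInt, this, Nat.add_sub_cancel]
  have e2 : B (a + 1 + c) μ ν (a + 1 + 1) α = betaInt (ν / μ) (a + 2) (c - 1) (α - 1) := by
    have : a + 1 + c - (a + 1 + 1) = c - 1 := by omega
    simp only [B, betaInt, this]
  rw [h1] at h
  rw [e0, e1, e2, h]
  push_cast
  field_simp
  ring

/-- The combination of `B` and `D` that is annihilated by the birth part of the Ehrenfest generator
at `C`, hence solves the eigenvalue equation of the process reflected at `C`. For `C = N` the birth
rate at `C` is `0` and `B` itself does so. -/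
def reflected (N C : ℕ) (μ ν α : ℝ) (x : ℕ) : ℝ :=
  if C < N then d N C μ ν α * B N μ ν x α + b N C μ ν α * D N μ ν x α else B N μ ν x α

lemma reflected_pos (hμ : 0 < μ) (hν : 0 < ν) (hα : 0 < α) (x : ℕ) :
    0 < reflected N C μ ν α x := by
  have hB := B_pos (N := N) hμ hν hα x
  have hD := D_pos (N := N) hμ hν hα x
  unfold reflected
  split_ifs with h
  · have := b_pos hμ hν hα h
    have := d_pos hμ hν hα h
    positivity
  · exact hB

lemma downRatio_eq (N C : ℕ) (μ ν α : ℝ) (x y : ℕ) :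
    downRatio N C μ ν x y α = reflected N C μ ν α y / reflected N C μ ν α x := by
  unfold downRatio reflected
  split_ifs <;> rfl

lemma reflected_recursion (hμ : 0 < μ) (hν : 0 < ν) (hμν : ν + μ = 1) (hα : 0 < α) (hCN : C ≤ N)
    {x : ℕ} (hx0 : 0 < x) (hx : x ≤ C) :
    μ * x * (reflected N C μ ν α (x - 1) - reflected N C μ ν α x) +
      ν * (N - x) * (reflected N C μ ν α (x + 1) - reflected N C μ ν α x) =
      α * reflected N C μ ν α x := by
  have hB := B_recursion hμ hν hμν hα hx0 (hx.trans hCN)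
  unfold reflected
  split_ifs with h
  · have hD := D_recursion hμ hν hμν hα (hx.trans_lt h)
    linear_combination d N C μ ν α * hB + b N C μ ν α * hD
  · exact hB

/-- The reflecting boundary condition at `C`. -/
lemma reflected_succ (hμ : 0 < μ) (hν : 0 < ν) (hα : 0 < α) (h : C < N) :
    reflected N C μ ν α (C + 1) = reflected N C μ ν α C := by
  obtain ⟨a, rfl⟩ : ∃ a, N = C + (a + 1) := ⟨N - C - 1, by omega⟩
  have h1 : C + (a + 1) - C = a + 1 := by omega
  have h2 : C + (a + 1) - (C + 1) = a := by omega
  simp only [reflected, if_pos h]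
  rw [b_eq_betaInt h, d_eq_betaInt h]
  change _ * betaInt _ _ _ _ + _ * betaInt _ _ _ _ = _ * betaInt _ _ _ _ + _ * betaInt _ _ _ _
  rw [h1, h2, Nat.add_sub_cancel, betaInt_succ_left _ C a hα, betaInt_succ_right _ C a hα,
    betaInt_succ_left _ a C hα, betaInt_succ_right _ a C hα]
  have e1 : μ * (ν / μ) = ν := by field_simp
  have e2 : ν * (μ / ν) = μ := by field_simp
  linear_combination betaInt (μ / ν) a C α * betaInt (ν / μ) C a α * (e2 - e1)

lemma sum_qMatrix_mul (F : ℕ → ℝ) (i : Fin (C + 1)) :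
    ∑ j : Fin (C + 1), qMatrix N C μ ν i j * F j =
      μ * (i : ℕ) * (F (i - 1) - F i) +
        if (i : ℕ) < C then ν * ((N : ℝ) - (i : ℕ)) * (F (i + 1) - F i) else 0 := by
  obtain ⟨x, hx⟩ := i
  have hsplit : ∀ j : Fin (C + 1), qMatrix N C μ ν ⟨x, hx⟩ j * F j =
      (if (j : ℕ) = x - 1 then μ * x * F j else 0) +
      (if (j : ℕ) = x + 1 then ν * (N - x) * F j else 0) -
      (if (j : ℕ) = x then (μ * x + if x < C then ν * (N - x) else 0) * F j else 0) := by
    rintro ⟨j, hj⟩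
    simp only [qMatrix, Fin.mk.injEq]
    rcases Nat.eq_zero_or_pos x with rfl | hx0
    · rcases Nat.eq_zero_or_pos j with rfl | hj0
      · simp
      · have h1 : j ≠ 0 := by omega
        by_cases h2 : j = 1 <;> simp [h1, h2]
    · by_cases h1 : j + 1 = x
      · have h2 : j = x - 1 := by omega
        have h3 : j ≠ x + 1 := by omega
        have h4 : j ≠ x := by omega
        rw [if_pos h1, if_pos h2, if_neg h3, if_neg h4]; ring
      · have h2 : j ≠ x - 1 := by omega
        rw [if_neg h1, if_neg h2]
        by_cases h3 : j = x + 1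
        · have h4 : j ≠ x := by omega
          rw [if_pos h3, if_pos h3, if_neg h4]; ring
        · rw [if_neg h3, if_neg h3]
          by_cases h4 : j = x
          · rw [if_pos h4, if_pos h4]; ring
          · rw [if_neg h4, if_neg h4]; ring
  rw [Finset.sum_congr rfl fun j _ => hsplit j, Finset.sum_sub_distrib, Finset.sum_add_distrib,
    Fin.sum_univ_eq_sum_range (fun j => if j = x - 1 then μ * x * F j else 0),
    Fin.sum_univ_eq_sum_range (fun j => if j = x + 1 then ν * (N - x) * F j else 0),
    Fin.sum_univ_eq_sum_range
      (fun j => if j = x then (μ * x + if x < C then ν * (N - x) else 0) * F j else 0)]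
  simp only [Finset.sum_ite_eq', Finset.mem_range]
  rw [if_pos (show x - 1 < C + 1 by omega), if_pos hx]
  by_cases h : x < C
  · rw [if_pos (by omega), if_pos h, if_pos h]; ring
  · rw [if_neg (by omega), if_neg h, if_neg h]; ring

/-- The function `w ↦ E_w (e^(-α T_z))`: below `z` it is proportional to `D`, which satisfies the
equation at `0`, above `z` to `reflected`, which satisfies the one at `C`. -/
def hitLaplace (N C : ℕ) (μ ν α : ℝ) (z w : ℕ) : ℝ :=
  if w ≤ z then D N μ ν w α / D N μ ν z α
  else reflected N C μ ν α w / reflected N C μ ν α z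

lemma hitLaplace_of_le {z w : ℕ} (h : w ≤ z) :
    hitLaplace N C μ ν α z w = D N μ ν w α / D N μ ν z α := if_pos h

lemma hitLaplace_of_ge (hμ : 0 < μ) (hν : 0 < ν) (hα : 0 < α) {z w : ℕ} (h : z ≤ w) :
    hitLaplace N C μ ν α z w = reflected N C μ ν α w / reflected N C μ ν α z := by
  rcases h.eq_or_lt with rfl | h
  · rw [hitLaplace, if_pos le_rfl, div_self (D_pos hμ hν hα _).ne',
      div_self (reflected_pos hμ hν hα _).ne']
  · exact if_neg h.not_ge

lemma hitLaplace_self (hμ : 0 < μ) (hν : 0 < ν) (hα : 0 < α) (z : ℕ) :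
    hitLaplace N C μ ν α z z = 1 := by
  rw [hitLaplace_of_le le_rfl, div_self (D_pos hμ hν hα _).ne']

lemma sum_qMatrix_mul_hitLaplace (hμ : 0 < μ) (hν : 0 < ν) (hμν : ν + μ = 1) (hα : 0 < α)
    (hCN : C ≤ N) (z i : Fin (C + 1)) (hi : i ≠ z) :
    ∑ j : Fin (C + 1), qMatrix N C μ ν i j * hitLaplace N C μ ν α z j =
      α * hitLaplace N C μ ν α z i := by
  rw [sum_qMatrix_mul]
  have hiC : (i : ℕ) ≤ C := Nat.lt_succ_iff.1 i.2
  have hzC : (z : ℕ) ≤ C := Nat.lt_succ_iff.1 z.2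
  have hne : (i : ℕ) ≠ z := fun h => hi (Fin.ext h)
  rcases hne.lt_or_gt with h | h
  · have hz := (D_pos (N := N) hμ hν hα z).ne'
    rw [if_pos (by omega), hitLaplace_of_le (by omega), hitLaplace_of_le (by omega),
      hitLaplace_of_le (by omega)]
    have := D_recursion (N := N) hμ hν hμν hα (x := i) (by omega)
    field_simp
    linear_combination this
  · have hz := (reflected_pos (N := N) (C := C) hμ hν hα z).ne'
    have hrec := reflected_recursion hμ hν hμν hα hCN (x := i) (by omega) hiC
    rw [hitLaplace_of_ge hμ hν hα h.le, hitLaplace_of_ge hμ hν hα (show (z : ℕ) ≤ i - 1 by omega),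
      hitLaplace_of_ge hμ hν hα (show (z : ℕ) ≤ i + 1 by omega)]
    split_ifs with hlt
    · field_simp
      linear_combination hrec
    · -- At `i = C` the birth term vanishes, either by reflection or because `N - C = 0`.
      have hi' : (i : ℕ) = C := by omega
      have h0 : ν * ((N : ℝ) - (i : ℕ)) *
          (reflected N C μ ν α (i + 1) - reflected N C μ ν α i) = 0 := by
        rw [hi']
        rcases hCN.lt_or_eq with hlt' | heq
        · rw [reflected_succ hμ hν hα hlt']; ring
        · rw [heq]; ring
      rw [h0] at hrec
      field_simp
      linear_combination hrec

/-! ### The limit `α → 0⁺` -/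

lemma tendsto_upRatio (hμ : 0 < μ) (hν : 0 < ν) (x y : ℕ) :
    Tendsto (upRatio N μ ν x y) (𝓝[>] 0) (𝓝 1) := by
  have h := (tendsto_mul_betaInt (div_pos hμ hν) (N - x) x).div
    (tendsto_mul_betaInt (div_pos hμ hν) (N - y) y) one_ne_zero
  rw [div_one] at h
  refine h.congr' ?_
  filter_upwards [self_mem_nhdsWithin] with α (hα : 0 < α)
  exact mul_div_mul_left _ _ hα.ne'

lemma tendsto_B_ratio (hμ : 0 < μ) (hν : 0 < ν) (x y : ℕ) :
    Tendsto (fun α => B N μ ν y α / B N μ ν x α) (𝓝[>] 0) (𝓝 1) := by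
  have h := (tendsto_mul_betaInt (div_pos hν hμ) y (N - y)).div
    (tendsto_mul_betaInt (div_pos hν hμ) x (N - x)) one_ne_zero
  rw [div_one] at h
  refine h.congr' ?_
  filter_upwards [self_mem_nhdsWithin] with α (hα : 0 < α)
  exact mul_div_mul_left _ _ hα.ne'

/-- The ratio is a mediant of `B_y / B_x` and `D_y / D_x`, so it lies between the two. -/
lemma tendsto_downRatio (hμ : 0 < μ) (hν : 0 < ν) (x y : ℕ) :
    Tendsto (downRatio N C μ ν x y) (𝓝[>] 0) (𝓝 1) := by
  have hB := tendsto_B_ratio (N := N) hμ hν x y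
  by_cases h : C < N
  · have hD : Tendsto (fun α => D N μ ν y α / D N μ ν x α) (𝓝[>] 0) (𝓝 1) :=
      tendsto_upRatio hμ hν y x
    have hmin := hB.min hD
    have hmax := hB.max hD
    rw [min_self] at hmin
    rw [max_self] at hmax
    have hbound : ∀ α : ℝ, 0 < α →
        min (B N μ ν y α / B N μ ν x α) (D N μ ν y α / D N μ ν x α) ≤ downRatio N C μ ν x y α ∧
        downRatio N C μ ν x y α ≤
          max (B N μ ν y α / B N μ ν x α) (D N μ ν y α / D N μ ν x α) := by
      intro α hα
      have hBx := B_pos (N := N) hμ hν hα x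
      have hDx := D_pos (N := N) hμ hν hα x
      have hb := b_pos hμ hν hα h
      have hd := d_pos hμ hν hα h
      simp only [downRatio, if_pos h]
      rw [le_div_iff₀ (by positivity), div_le_iff₀ (by positivity), mul_add, mul_add]
      set p := B N μ ν y α / B N μ ν x α with hp
      set q := D N μ ν y α / D N μ ν x α with hq
      have ep : B N μ ν y α = p * B N μ ν x α := by rw [hp]; field_simp
      have eq : D N μ ν y α = q * D N μ ν x α := by rw [hq]; field_simp
      have e : d N C μ ν α * B N μ ν y α + b N C μ ν α * D N μ ν y α =
          p * (d N C μ ν α * B N μ ν x α) + q * (b N C μ ν α * D N μ ν x α) := by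
        rw [ep, eq]; ring
      rw [e]
      exact ⟨by gcongr; exacts [min_le_left _ _, min_le_right _ _],
        by gcongr; exacts [le_max_left _ _, le_max_right _ _]⟩
    refine tendsto_of_tendsto_of_tendsto_of_le_of_le' hmin hmax ?_ ?_
    · filter_upwards [self_mem_nhdsWithin] with α hα
      exact (hbound α hα).1
    · filter_upwards [self_mem_nhdsWithin] with α hα
      exact (hbound α hα).2
  · refine hB.congr fun α => ?_
    rw [downRatio, if_neg h]

end Equations

/-- The Laplace transform of every hitting time of the Engset process. -/
lemma IsEngsetProcess.laplace_hitTime {N C : ℕ} (hCN : C ≤ N) {μ ν : ℝ} (hμ : 0 < μ) (hν : 0 < ν)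
    (hμν : ν + μ = 1) {Ω : Type*} [MeasurableSpace Ω] {P : MeasureTheory.Measure Ω}
    [MeasureTheory.IsProbabilityMeasure P] {X : ℝ≥0 → Ω → Fin (C + 1)}
    (hX : IsEngsetProcess P N C μ ν X) (z : Fin (C + 1)) {w : Fin (C + 1)}
    (hw : ∀ᵐ ω ∂P, X 0 ω = w) {α : ℝ} (hα : 0 < α) :
    laplace P (hitTime X z) α = hitLaplace N C μ ν α z w :=
  Engset.laplace_hitTime (f := fun w => hitLaplace N C μ ν α z w) hX hα
    (sum_qMatrix_mul_hitLaplace hμ hν hμν hα hCN z) (hitLaplace_self hμ hν hα z) hw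

end Engset

end

theorem mainTheorem2 (N C : ℕ) (hC : 1 ≤ C) (hCN : C ≤ N) (μ ν : ℝ) (hμ : 0 < μ) (hν : 0 < ν)
    (hμν : ν + μ = 1) {Ω : Type*} [MeasurableSpace Ω] (P : MeasureTheory.Measure Ω)
    [MeasureTheory.IsProbabilityMeasure P] (X : ℝ≥0 → Ω → Fin (C + 1))
    (hX : Engset.IsEngsetProcess P N C μ ν X) (x y : Fin (C + 1)) (hxy : x ≤ y) :
    ((∀ᵐ ω ∂P, X 0 ω = x) →
      (∀ α : ℝ, 0 < α →
        Engset.laplace P (Engset.hitTime X y) α = Engset.upRatio N μ ν x y α) ∧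
      Engset.laplace P (Engset.hitTime X y) 0 = 1 ∧
      Filter.Tendsto (Engset.upRatio N μ ν x y) (𝓝[>] 0) (𝓝 1)) ∧
    ((∀ᵐ ω ∂P, X 0 ω = y) →
      (∀ α : ℝ, 0 < α →
        Engset.laplace P (Engset.hitTime X x) α = Engset.downRatio N C μ ν x y α) ∧
      Engset.laplace P (Engset.hitTime X x) 0 = 1 ∧
      Filter.Tendsto (Engset.downRatio N C μ ν x y) (𝓝[>] 0) (𝓝 1)) := by
  refine ⟨fun h0 => ?_, fun h0 => ?_⟩
  · have hL : ∀ α : ℝ, 0 < α →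
        Engset.laplace P (Engset.hitTime X y) α = Engset.upRatio N μ ν x y α := fun α hα => by
      rw [hX.laplace_hitTime hCN hμ hν hμν y h0 hα, Engset.hitLaplace_of_le hxy, Engset.upRatio]
    have hlim := Engset.tendsto_upRatio (N := N) hμ hν x y
    refine ⟨hL, tendsto_nhds_unique (Engset.tendsto_laplace_hitTime hX y) (hlim.congr' ?_), hlim⟩
    filter_upwards [self_mem_nhdsWithin] with α hα
    exact (hL α hα).symm
  · have hL : ∀ α : ℝ, 0 < α →
        Engset.laplace P (Engset.hitTime X x) α = Engset.downRatio N C μ ν x y α := fun α hα => by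
      rw [hX.laplace_hitTime hCN hμ hν hμν x h0 hα, Engset.hitLaplace_of_ge hμ hν hα hxy,
        Engset.downRatio_eq]
    have hlim := Engset.tendsto_downRatio (N := N) (C := C) hμ hν x y
    refine ⟨hL, tendsto_nhds_unique (Engset.tendsto_laplace_hitTime hX x) (hlim.congr' ?_), hlim⟩
    filter_upwards [self_mem_nhdsWithin] with α hα
    exact (hL α hα).symm
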